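/- Consider a two-person zero-sum stochastic game with a finite state set $S$ and finite nonempty action sets $A_s$ (Player I, the maximizer) and $B_s$ (Player II), with additive rewards and transitions (ARAT): $r(s,i,j)=r^1_i(s)+r^2_j(s)$ and $p_{ij}(s,s')=p^1_i(s,s')+p^2_j(s,s')$ with $p^1,p^2\ge 0$. Let $\beta\in(0,1)$. A pair of strategies $(k^*,l^*)$ is optimal with value vector $v$ if $\phi_s(k,l^*)\le\phi_s(k^*,l^*)=v(s)\le\phi_s(k^*,l)$ for all $s$ and all (history-dependent, randomized) strategies $k,l$, where $\phi_s$ is the expected $\beta$-discounted payoff with initial state $s$. Let $P_1$, $P_2$ be the matrices with rows $p^1_i(s,\cdot)$ ($s\in S$, $i\in A_s$) and $p^2_j(s,\cdot)$ ($s\in S$, $j\in B_s$), let $E$ be the vertical block identity matrix (the entry in a row belonging to $s$ and the column $s'$ is $1$ if $s=s'$ and $0$ otherwise), and let $$\mathcal A=\begin{bmatrix}-\beta P_1&E-\beta P_1\\-E+\beta P_2&\beta P_2\end{bmatrix},\qquad q=\begin{bmatrix}-r^1\\ r^2\end{bmatrix}.$$ The columns of $\mathcal A$ are indexed by two copies of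 $S$, so vectors are $z=(\eta,\xi)$; the block of the column $\eta(s)$ consists of the rows $(s,i)$, $i\in A_s$, and that of $\xi(s)$ of the rows $(s,j)$, $j\in B_s$. VLCP$(q,\mathcal A)$ asks for $w=\mathcal Az+q\ge0$, $z\ge0$ with $z_c\prod_{p\text{ in block }c}w_p=0$ for every column $c$. Let $A$ be the square matrix obtained from $\mathcal A$ by repeating each column $c$ once for each row of the block $c$, and let $n$ be its order. LCP$(q,A)$ asks for $w=Ax+q\ge 0$, $x\ge 0$ with $x^Tw=0$. Then: 1. Pure stationary strategies $f$ (Player I) and $g$ (Player II) are optimal with value vector $v$ if and only if the Shapley inequalities hold: for all $s$, $r(s,i,g(s))+\beta\sum_{s'}p_{i\,g(s)}(s,s')v(s')\le v(s)$ for all $i\in A_s$, and $r(s,f(s),j)+\beta\sum_{s'}p_{f(s)\,j}(s,s')v(s')\ge v(s)$ for all $j\in B_s$. 2. For strictly positive $\eta,\xi\in\mathbb R^S$, $(\eta,\xi)$ solves VLCP$(q,\mathcal A)$ if and only if there are $f,g$ such that the Shapley inequalities hold with $v=\xi+\eta$, and for all $s$, $\xi(s)=r^1_{f(s)}(s)+\beta\sum_{s'}p^1_{f(s)}(s,s')v(s')$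 and $\eta(s)=r^2_{g(s)}(s)+\beta\sum_{s'}p^2_{g(s)}(s,s')v(s')$. 3. If all $r^1_i(s)$ and $r^2_j(s)$ are positive, every solution $z$ of VLCP$(q,\mathcal A)$ is strictly positive. Positivity of the rewards is no loss of generality: it can be reached by adding a constant $c_1$ to all $r^1_i(s)$ and a constant $c_2$ to all $r^2_j(s)$, and for all $c_1,c_2$ and $v$, a pair of strategies is optimal with value vector $v$ in the given game if and only if it is optimal with value vector $v+\frac{c_1+c_2}{1-\beta}$ (in every state) in the game so changed. 4. $(w,z)$ solves VLCP$(q,\mathcal A)$ if and only if some $(w,x)$ solves LCP$(q,A)$ with $z_c=\sum_{p\text{ in block }c}x_p$ for all $c$. 5. Let $\mathcal R_1$ be the set of $u=(x,y_1,y_2)\in\mathbb R^{3n}$ with $x>0$, $Ax+q>0$, $y_1>0$, $y_2>0$, and $\bar{\mathcal R}_1$ the set defined by the same inequalities with $\ge$. Let $u^{(0)}=(x^{(0)},y_1^{(0)},y_2^{(0)})\in\mathcal R_1$, and $$H(u,t)=\begin{bmatrix}(1-t)[(A+A^T)x+q-y_1-A^Ty_2]+t(x-x^{(0)})\\ Y_1x-tY_1^{(0)}x^{(0)}+(1-t)X(Ax+q)\\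 Y_2(Ax+q)-tY_2^{(0)}(Ax^{(0)}+q)\end{bmatrix},$$ with $X=\mathrm{diag}(x)$, $Y_i=\mathrm{diag}(y_i)$, $Y_i^{(0)}=\mathrm{diag}(y_i^{(0)})$. Let $\Gamma=\{(u,t)\in\mathcal R_1\times(0,1]:H(u,t)=0\}$. Then: (a) if $C\subseteq\Gamma$ is bounded and $t$ takes values arbitrarily close to $0$ on $C$, then some $(\bar u,0)$ lies in the closure of $C$; (b) if $(\bar u,0)$ lies in the closure of $\Gamma$, then $\bar u\in\bar{\mathcal R}_1$ and $H(\bar u,0)=0$; (c) if $\bar u=(\bar x,\bar y_1,\bar y_2)\in\bar{\mathcal R}_1$ and $H(\bar u,0)=0$, then with $w=A\bar x+q$ and with $z=(\eta,\xi)$ the vector of the block sums of $\bar x$, $(w,\bar x)$ solves LCP$(q,A)$ and $(w,z)$ solves VLCP$(q,\mathcal A)$. If all $r^1_i(s),r^2_j(s)$ are positive, then $z$ is strictly positive. Whenever $z$ is strictly positive, there are in each state $s$ an $i\in A_s$ and a $j\in B_s$ with $w_{(s,i)}=0$ and $w_{(s,j)}=0$, the value vector of the discounted ARAT game is $\xi+\eta$,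 and any pure stationary strategies $f,g$ that choose in each state such actions are optimal. -/

import Mathlib

/-! Complementarity problems. The rows of a vertical block matrix are indexed by `ι`, its columns by
`κ`, and `blk i` is the column to whose block the row `i` belongs. -/

section Complementarity

variable {ι κ : Type*} [Fintype ι] [Fintype κ]

/-- `(w, x)` solves the linear complementarity problem LCP(q, A). -/
def IsLCPSolution (A : Matrix ι ι ℝ) (q w x : ι → ℝ) : Prop :=
  w - A.mulVec x = q ∧ 0 ≤ w ∧ 0 ≤ x ∧ dotProduct x w = 0

/-- `(w, z)` solves the vertical linear complementarity problem VLCP(q, A): in the block of each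
column `j`, `z j` times the product of the entries of `w` in that block is zero. -/
def IsVLCPSolution [DecidableEq κ] (blk : ι → κ) (A : Matrix ι κ ℝ) (q w : ι → ℝ) (z : κ → ℝ) :
    Prop :=
  w - A.mulVec z = q ∧ 0 ≤ w ∧ 0 ≤ z ∧ ∀ j, z j * ∏ i with blk i = j, w i = 0

/-- The equivalent square matrix of a vertical block matrix: the column `j` is copied once for each
row of the block `j`. -/
def equivalentSquare (blk : ι → κ) (A : Matrix ι κ ℝ) : Matrix ι ι ℝ :=
  Matrix.of fun i p => A i (blk p)

/-- The block sums of a vector indexed by the rows. -/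
def blockSum [DecidableEq κ] (blk : ι → κ) (x : ι → ℝ) : κ → ℝ :=
  fun j => ∑ i with blk i = j, x i

end Complementarity

/-! The homotopy function. A point is `u = (x, y₁, y₂)`. -/

section Homotopy

variable {ι : Type*} [Fintype ι]

/-- The open region: `x > 0`, `A x + q > 0`, `y₁ > 0`, `y₂ > 0`, entrywise. -/
def regionOpen (A : Matrix ι ι ℝ) (q : ι → ℝ) : Set ((ι → ℝ) × (ι → ℝ) × (ι → ℝ)) :=
  {u | (∀ i, 0 < u.1 i) ∧ (∀ i, 0 < (A.mulVec u.1 + q) i) ∧ (∀ i, 0 < u.2.1 i) ∧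
    ∀ i, 0 < u.2.2 i}

/-- The closed region: `x ≥ 0`, `A x + q ≥ 0`, `y₁ ≥ 0`, `y₂ ≥ 0`, entrywise. -/
def regionClosed (A : Matrix ι ι ℝ) (q : ι → ℝ) : Set ((ι → ℝ) × (ι → ℝ) × (ι → ℝ)) :=
  {u | (∀ i, 0 ≤ u.1 i) ∧ (∀ i, 0 ≤ (A.mulVec u.1 + q) i) ∧ (∀ i, 0 ≤ u.2.1 i) ∧
    ∀ i, 0 ≤ u.2.2 i}

/-- The homotopy function with initial point `u₀`. The product of two vectors is entrywise, that is,
`y * x` is `diag(y) x`. -/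
def homotopy (A : Matrix ι ι ℝ) (q : ι → ℝ) (u₀ u : (ι → ℝ) × (ι → ℝ) × (ι → ℝ)) (t : ℝ) :
    (ι → ℝ) × (ι → ℝ) × (ι → ℝ) :=
  ((1 - t) • ((A + A.transpose).mulVec u.1 + q - u.2.1 - A.transpose.mulVec u.2.2)
      + t • (u.1 - u₀.1),
    u.2.1 * u.1 - t • (u₀.2.1 * u₀.1) + (1 - t) • (u.1 * (A.mulVec u.1 + q)),
    u.2.2 * (A.mulVec u.1 + q) - t • (u₀.2.2 * (A.mulVec u₀.1 + q)))

/-- The zeros `(u, t)` of the homotopy function with `u` in the open region and `0 < t ≤ 1`. -/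
def homotopyZeros (A : Matrix ι ι ℝ) (q : ι → ℝ) (u₀ : (ι → ℝ) × (ι → ℝ) × (ι → ℝ)) :
    Set (((ι → ℝ) × (ι → ℝ) × (ι → ℝ)) × ℝ) :=
  {p | p.1 ∈ regionOpen A q ∧ 0 < p.2 ∧ p.2 ≤ 1 ∧ homotopy A q u₀ p.1 p.2 = 0}

end Homotopy

/-! Two-person zero-sum stochastic games with finite state and action sets. -/

/-- In state `s`, Player I chooses an action in `A s`, Player II one in `B s`; `r s i j` is paid by
Player II to Player I, and the next state is `s'` with probability `p s i j s'`. -/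
structure StochasticGame (S : Type*) (A B : S → Type*) [Fintype S] where
  r : ∀ s, A s → B s → ℝ
  p : ∀ s, A s → B s → S → ℝ
  p_nonneg : ∀ s i j s', 0 ≤ p s i j s'
  p_sum : ∀ s i j, ∑ s', p s i j s' = 1

/-- The list of the past stages, the latest first: state, action of I, action of II. -/
abbrev History (S : Type*) (A B : S → Type*) := List (Σ s : S, A s × B s)

/-- A behavioural strategy of a player with action sets `X s`: `prob h s a` is the probability of the
action `a` in the current state `s` after the history `h`. -/
structure GameStrategy (S : Type*) (A B X : S → Type*) [∀ s, Fintype (X s)] where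
  prob : History S A B → ∀ s, X s → ℝ
  prob_nonneg : ∀ h s a, 0 ≤ prob h s a
  prob_sum : ∀ h s, ∑ a, prob h s a = 1

/-- The pure stationary strategy that plays `f s` whenever the state is `s`. -/
def pureStationary {S : Type*} (A B : S → Type*) {X : S → Type*} [∀ s, Fintype (X s)]
    [∀ s, DecidableEq (X s)] (f : ∀ s, X s) : GameStrategy S A B X where
  prob _ s a := if a = f s then 1 else 0
  prob_nonneg _ s a := by split_ifs <;> norm_num
  prob_sum _ s := by simp

namespace StochasticGame

variable {S : Type*} {A B : S → Type*} [Fintype S] [∀ s, Fintype (A s)] [∀ s, Fintype (B s)]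

/-- The expected payoff to Player I, `t` stages from now, when the past is `h` and the current state
is `s`. -/
noncomputable def stagePayoff (G : StochasticGame S A B) (σ : GameStrategy S A B A)
    (τ : GameStrategy S A B B) : ℕ → History S A B → S → ℝ
  | 0, h, s => ∑ i, ∑ j, σ.prob h s i * τ.prob h s j * G.r s i j
  | t + 1, h, s => ∑ i, ∑ j, σ.prob h s i * τ.prob h s j *
      ∑ s', G.p s i j s' * stagePayoff G σ τ t (⟨s, i, j⟩ :: h) s'

/-- The expected `β`-discounted payoff to Player I with initial state `s`. -/
noncomputable def discountedPayoff (G : StochasticGame S A B) (β : ℝ) (σ : GameStrategy S A B A)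
    (τ : GameStrategy S A B B) (s : S) : ℝ :=
  ∑' t : ℕ, β ^ t * G.stagePayoff σ τ t [] s

/-- `σ` and `τ` are optimal and `v` is the value vector of the `β`-discounted game. -/
def IsOptimalPair (G : StochasticGame S A B) (β : ℝ) (v : S → ℝ) (σ : GameStrategy S A B A)
    (τ : GameStrategy S A B B) : Prop :=
  ∀ s, (∀ σ', G.discountedPayoff β σ' τ s ≤ v s) ∧ G.discountedPayoff β σ τ s = v s ∧
    ∀ τ', v s ≤ G.discountedPayoff β σ τ' s

/-- The Shapley inequalities for the vector `v` at the pure actions `f s`, `g s`. -/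
def ShapleyInequalities (G : StochasticGame S A B) (β : ℝ) (v : S → ℝ) (f : ∀ s, A s)
    (g : ∀ s, B s) : Prop :=
  ∀ s, (∀ i, G.r s i (g s) + β * ∑ s', G.p s i (g s) s' * v s' ≤ v s) ∧
    ∀ j, v s ≤ G.r s (f s) j + β * ∑ s', G.p s (f s) j s' * v s'

end StochasticGame

/-- The data of a stochastic game with additive rewards and additive transitions: the reward is
`r₁ s i + r₂ s j` and the transition probability is `p₁ s i s' + p₂ s j s'`, the components being
nonnegative. -/
structure ARATGame (S : Type*) (A B : S → Type*) [Fintype S] where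
  r₁ : ∀ s, A s → ℝ
  r₂ : ∀ s, B s → ℝ
  p₁ : ∀ s, A s → S → ℝ
  p₂ : ∀ s, B s → S → ℝ
  p₁_nonneg : ∀ s i s', 0 ≤ p₁ s i s'
  p₂_nonneg : ∀ s j s', 0 ≤ p₂ s j s'
  p_sum : ∀ s i j, ∑ s', (p₁ s i s' + p₂ s j s') = 1

namespace ARATGame

variable {S : Type*} {A B : S → Type*} [Fintype S]

/-- The stochastic game with the given additive components. -/
def toStochasticGame (G : ARATGame S A B) : StochasticGame S A B where
  r s i j := G.r₁ s i + G.r₂ s j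
  p s i j s' := G.p₁ s i s' + G.p₂ s j s'
  p_nonneg s i j s' := add_nonneg (G.p₁_nonneg s i s') (G.p₂_nonneg s j s')
  p_sum := G.p_sum

/-- The game in which `c₁` is added to every `r₁ s i` and `c₂` to every `r₂ s j`. -/
def shift (G : ARATGame S A B) (c₁ c₂ : ℝ) : ARATGame S A B where
  r₁ s i := G.r₁ s i + c₁
  r₂ s j := G.r₂ s j + c₂
  p₁ := G.p₁
  p₂ := G.p₂
  p₁_nonneg := G.p₁_nonneg
  p₂_nonneg := G.p₂_nonneg
  p_sum := G.p_sum

/-- All the components of the rewards are positive. -/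
def PositiveRewards (G : ARATGame S A B) : Prop :=
  (∀ s i, 0 < G.r₁ s i) ∧ ∀ s j, 0 < G.r₂ s j

/-- `r₁ s i + β ∑ p₁ s i s' v s'`. -/
noncomputable def part₁ (G : ARATGame S A B) (β : ℝ) (v : S → ℝ) (s : S) (i : A s) : ℝ :=
  G.r₁ s i + β * ∑ s', G.p₁ s i s' * v s'

/-- `r₂ s j + β ∑ p₂ s j s' v s'`. -/
noncomputable def part₂ (G : ARATGame S A B) (β : ℝ) (v : S → ℝ) (s : S) (j : B s) : ℝ :=
  G.r₂ s j + β * ∑ s', G.p₂ s j s' * v s'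

/-- The matrix `P₁`, whose blocks are the matrices `P₁(s)`. -/
def P₁ (G : ARATGame S A B) : Matrix (Σ s, A s) S ℝ :=
  Matrix.of fun a s' => G.p₁ a.1 a.2 s'

/-- The matrix `P₂`, whose blocks are the matrices `P₂(s)`. -/
def P₂ (G : ARATGame S A B) : Matrix (Σ s, B s) S ℝ :=
  Matrix.of fun b s' => G.p₂ b.1 b.2 s'

/-- The vertical block identity matrix. -/
def blockIdentity [DecidableEq S] (X : S → Type*) : Matrix (Σ s, X s) S ℝ :=
  Matrix.of fun a s' => if a.1 = s' then 1 else 0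

/-- The rows of `verticalMatrix` for the actions of Player I in state `s` form the block of the column
`inl s`, those for the actions of Player II in state `s` the block of the column `inr s`. -/
def block (A B : S → Type*) : (Σ s, A s) ⊕ (Σ s, B s) → S ⊕ S :=
  Sum.map Sigma.fst Sigma.fst

/-- The vertical block matrix `[[-β P₁, E - β P₁], [-E + β P₂, β P₂]]`. -/
noncomputable def verticalMatrix [DecidableEq S] (G : ARATGame S A B) (β : ℝ) :
    Matrix ((Σ s, A s) ⊕ (Σ s, B s)) (S ⊕ S) ℝ :=
  Matrix.fromBlocks (-(β • G.P₁)) (blockIdentity A - β • G.P₁)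
    (-blockIdentity B + β • G.P₂) (β • G.P₂)

/-- The vector `(-r₁, r₂)`. -/
def rhs (G : ARATGame S A B) : (Σ s, A s) ⊕ (Σ s, B s) → ℝ :=
  Sum.elim (fun a => -G.r₁ a.1 a.2) (fun b => G.r₂ b.1 b.2)

/-- The square matrix of the equivalent linear complementarity problem. -/
noncomputable def squareMatrix [DecidableEq S] (G : ARATGame S A B) (β : ℝ) :
    Matrix ((Σ s, A s) ⊕ (Σ s, B s)) ((Σ s, A s) ⊕ (Σ s, B s)) ℝ :=
  equivalentSquare (block A B) (G.verticalMatrix β)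

end ARATGame

/-! Everything rests on one-stage expressions `r + β ∑ p v`.

Optimality and Shapley inequalities. Fix `g` and let Player I play any strategy. The excess of the
continuation payoff over `v`, as a function of history and state, is bounded, and the Shapley
inequalities show that a bound `c` on it improves to `β * c`; hence it is at most zero
(`le_zero_of_contracting`). The same holds with the players exchanged. Conversely, deviating from an
optimal pair in the first stage only, and then returning to it, pays exactly the one-stage
expression with continuation `v`, so optimality gives the inequalities.

ARAT structure. The one-stage expression splits as `part₁ i + part₂ j` (`reward_add_eq`), so the two
players' choices decouple: `f` maximizes `part₁`, `g` minimizes `part₂`, and `ξ`, `η` are these two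
extrema. The rows of the VLCP are the slacks `ξ - part₁` and `part₂ - η`; for positive `z`,
complementarity demands a zero slack in each block, that is, an action attaining the extremum.

VLCP and LCP. Repeated columns act on `x` only through its block sums. Conversely, `z c` can be
placed on a single row of the block where `w` vanishes.

Homotopy. The equations and the weak inequalities are closed conditions, so they pass to limits. At
`t = 0` the second equation writes zero as a sum of the nonnegative vectors `y₁ * x` and `x * (A x +
q)`, which is complementarity. -/

section Complementarity

/-! ### The vertical problem and its equivalent square problem. -/

variable {ι κ : Type*} [Fintype ι] [Fintype κ]

theorem equivalentSquare_mulVec [DecidableEq κ] (blk : ι → κ) (A : Matrix ι κ ℝ) (x : ι → ℝ) :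
    (equivalentSquare blk A).mulVec x = A.mulVec (blockSum blk x) := by
  funext i
  simp only [equivalentSquare, Matrix.mulVec, dotProduct, Matrix.of_apply, blockSum, Finset.mul_sum]
  rw [← Finset.sum_fiberwise Finset.univ blk]
  refine Finset.sum_congr rfl fun j _ => Finset.sum_congr rfl fun p hp => ?_
  rw [(Finset.mem_filter.1 hp).2]

theorem IsLCPSolution.apply_mul_apply_eq_zero {A : Matrix ι ι ℝ} {q w x : ι → ℝ}
    (h : IsLCPSolution A q w x) (i : ι) : x i * w i = 0 :=
  (Finset.sum_eq_zero_iff_of_nonneg fun i _ => mul_nonneg (h.2.2.1 i) (h.2.1 i)).1 h.2.2.2 i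
    (Finset.mem_univ i)

/-- A block in which `w` has no zero carries only zero entries of `x`, so its block sum vanishes. -/
theorem IsLCPSolution.isVLCPSolution [DecidableEq κ] {blk : ι → κ} {A : Matrix ι κ ℝ}
    {q w x : ι → ℝ} (h : IsLCPSolution (equivalentSquare blk A) q w x) :
    IsVLCPSolution blk A q w (blockSum blk x) := by
  refine ⟨by rw [← equivalentSquare_mulVec]; exact h.1, h.2.1,
    fun j => Finset.sum_nonneg fun i _ => h.2.2.1 i, fun j => ?_⟩
  by_cases hw : ∃ i ∈ Finset.univ.filter (fun i => blk i = j), w i = 0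
  · rw [Finset.prod_eq_zero_iff.2 hw, mul_zero]
  · push Not at hw
    rw [blockSum, Finset.sum_eq_zero fun i hi => ?_, zero_mul]
    exact (mul_eq_zero.1 (h.apply_mul_apply_eq_zero i)).resolve_right (hw i hi)

theorem IsVLCPSolution.exists_isLCPSolution [DecidableEq κ] {blk : ι → κ} {A : Matrix ι κ ℝ}
    {q w : ι → ℝ} {z : κ → ℝ} (h : IsVLCPSolution blk A q w z) :
    ∃ x, IsLCPSolution (equivalentSquare blk A) q w x ∧ blockSum blk x = z := by
  classical
  obtain ⟨h₁, h₂, h₃, h₄⟩ := h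
  -- One vector per block: zero if `z j = 0`, otherwise `z j` on one row where `w` vanishes. The
  -- solution takes from each only the entries of its own block.
  have key : ∀ j, ∃ y : ι → ℝ, (∀ i, 0 ≤ y i) ∧ (∀ i, y i * w i = 0) ∧
      ∑ i with blk i = j, y i = z j := by
    intro j
    rcases mul_eq_zero.1 (h₄ j) with hz | hw
    · exact ⟨0, by simp, by simp, by simp [hz]⟩
    · obtain ⟨p, hp, hwp⟩ := Finset.prod_eq_zero_iff.1 hw
      refine ⟨Pi.single p (z j), fun i => ?_, fun i => ?_, ?_⟩
      · have hz : (0 : ι → ℝ) ≤ Pi.single p (z j) := Pi.single_nonneg.2 (h₃ j)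
        exact hz i
      · rcases eq_or_ne i p with rfl | hi
        · rw [hwp, mul_zero]
        · rw [Pi.single_eq_of_ne hi, zero_mul]
      · rw [Finset.sum_eq_single_of_mem p hp fun i _ hi => Pi.single_eq_of_ne hi _,
          Pi.single_eq_same]
  choose y hy₁ hy₂ hy₃ using key
  have hsum : blockSum blk (fun i => y (blk i) i) = z := by
    funext j
    rw [← hy₃ j]
    refine Finset.sum_congr rfl fun i hi => ?_
    simp only [(Finset.mem_filter.1 hi).2]
  refine ⟨fun i => y (blk i) i, ⟨?_, h₂, fun i => hy₁ _ i, ?_⟩, hsum⟩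
  · rw [equivalentSquare_mulVec, hsum, h₁]
  · exact Finset.sum_eq_zero fun i _ => hy₂ _ i

end Complementarity

/-! ### Limits of zeros of the homotopy function. -/

section Homotopy

variable {ι : Type*} [Fintype ι]

/-- The closure of `C` is compact, so its projection is closed and contains every limit of the
parameters taken on `C`. -/
theorem exists_mem_closure_of_mem_closure_snd {X : Type*} [PseudoMetricSpace X] [ProperSpace X]
    {C : Set (X × ℝ)} (hC : Bornology.IsBounded C) {t : ℝ} (ht : t ∈ closure (Prod.snd '' C)) :
    ∃ u, (u, t) ∈ closure C := by
  have hclosed : IsClosed (Prod.snd '' closure C) :=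
    (hC.isCompact_closure.image continuous_snd).isClosed
  obtain ⟨⟨u, t'⟩, hu, rfl⟩ :=
    closure_minimal (Set.image_mono subset_closure) hclosed ht
  exact ⟨u, hu⟩

theorem continuous_homotopy (A : Matrix ι ι ℝ) (q : ι → ℝ)
    (u₀ : (ι → ℝ) × (ι → ℝ) × (ι → ℝ)) :
    Continuous fun p : ((ι → ℝ) × (ι → ℝ) × (ι → ℝ)) × ℝ => homotopy A q u₀ p.1 p.2 := by
  have h : ∀ (M : Matrix ι ι ℝ) (φ : ((ι → ℝ) × (ι → ℝ) × (ι → ℝ)) × ℝ → ι → ℝ),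
      Continuous φ → Continuous fun p => M.mulVec (φ p) :=
    fun M φ hφ => continuous_const.matrix_mulVec hφ
  have h₁ := h A (fun p => p.1.1) (by fun_prop)
  have h₂ := h (A + A.transpose) (fun p => p.1.1) (by fun_prop)
  have h₃ := h A.transpose (fun p => p.1.2.2) (by fun_prop)
  unfold homotopy
  fun_prop

theorem isClosed_regionClosed (A : Matrix ι ι ℝ) (q : ι → ℝ) : IsClosed (regionClosed A q) := by
  have h₁ : Continuous fun u : (ι → ℝ) × (ι → ℝ) × (ι → ℝ) => A.mulVec u.1 + q :=
    (continuous_const.matrix_mulVec continuous_fst).add continuous_const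
  simp only [regionClosed, Set.ofPred_and, Set.ofPred_forall]
  refine IsClosed.inter ?_ (IsClosed.inter ?_ (IsClosed.inter ?_ ?_)) <;>
    refine isClosed_iInter fun i => isClosed_le continuous_const ?_
  · fun_prop
  · exact (continuous_apply i).comp h₁
  · fun_prop
  · fun_prop

theorem regionOpen_subset_regionClosed (A : Matrix ι ι ℝ) (q : ι → ℝ) :
    regionOpen A q ⊆ regionClosed A q := fun _ h =>
  ⟨fun i => (h.1 i).le, fun i => (h.2.1 i).le, fun i => (h.2.2.1 i).le, fun i => (h.2.2.2 i).le⟩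

theorem mem_regionClosed_and_homotopy_eq_zero {A : Matrix ι ι ℝ} {q : ι → ℝ}
    {u₀ u : (ι → ℝ) × (ι → ℝ) × (ι → ℝ)} {t : ℝ} (h : (u, t) ∈ closure (homotopyZeros A q u₀)) :
    u ∈ regionClosed A q ∧ homotopy A q u₀ u t = 0 := by
  have hclosed : IsClosed {p : ((ι → ℝ) × (ι → ℝ) × (ι → ℝ)) × ℝ |
      p.1 ∈ regionClosed A q ∧ homotopy A q u₀ p.1 p.2 = 0} :=
    ((isClosed_regionClosed A q).preimage continuous_fst).inter
      (isClosed_singleton.preimage (continuous_homotopy A q u₀))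
  have hsub : homotopyZeros A q u₀ ⊆ {p | p.1 ∈ regionClosed A q ∧ homotopy A q u₀ p.1 p.2 = 0} :=
    fun p hp => ⟨regionOpen_subset_regionClosed A q hp.1, hp.2.2.2⟩
  exact closure_minimal hsub hclosed h

/-- Only the second component of the homotopy function matters here: at `t = 0` it is a vanishing
sum of two nonnegative terms. -/
theorem isLCPSolution_of_homotopy_eq_zero {A : Matrix ι ι ℝ} {q : ι → ℝ}
    {u₀ u : (ι → ℝ) × (ι → ℝ) × (ι → ℝ)} (hu : u ∈ regionClosed A q)
    (h : homotopy A q u₀ u 0 = 0) : IsLCPSolution A q (A.mulVec u.1 + q) u.1 := by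
  obtain ⟨hx, hw, hy, -⟩ := hu
  refine ⟨add_sub_cancel_left _ _, hw, hx, Finset.sum_eq_zero fun i _ => ?_⟩
  have h₂ := congrFun (congrArg (fun p => p.2.1) h) i
  simp only [homotopy, Pi.add_apply, Pi.sub_apply, Pi.mul_apply, Pi.smul_apply, smul_eq_mul,
    Prod.snd_zero, Prod.fst_zero, Pi.zero_apply] at h₂
  have h₃ := mul_nonneg (hy i) (hx i)
  have h₄ := mul_nonneg (hx i) (hw i)
  simp only [Pi.add_apply] at h₄ ⊢
  linarith

end Homotopy

/-! ### Averages over mixed actions, contraction, and one-stage deviations. -/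

section Mixed

variable {I J : Type*} [Fintype I] [Fintype J] {a : I → ℝ} {b : J → ℝ}

theorem sum_mul_const_of_sum_eq_one (ha : ∑ i, a i = 1) (hb : ∑ j, b j = 1) (c : ℝ) :
    ∑ i, ∑ j, a i * b j * c = c := by
  simp only [← Finset.sum_mul, ← Finset.mul_sum, ha, hb, one_mul, mul_one]

/-- The bound is required only where both probabilities are nonzero, so that against a pure strategy
only the chosen action has to be examined. -/
theorem sum_mul_le_of_sum_eq_one (ha₀ : ∀ i, 0 ≤ a i) (hb₀ : ∀ j, 0 ≤ b j) (ha : ∑ i, a i = 1)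
    (hb : ∑ j, b j = 1) {x : I → J → ℝ} {c : ℝ}
    (hx : ∀ i j, a i ≠ 0 → b j ≠ 0 → x i j ≤ c) : ∑ i, ∑ j, a i * b j * x i j ≤ c := by
  rw [← sum_mul_const_of_sum_eq_one ha hb c]
  refine Finset.sum_le_sum fun i _ => Finset.sum_le_sum fun j _ => ?_
  by_cases hi : a i = 0
  · simp [hi]
  by_cases hj : b j = 0
  · simp [hj]
  exact mul_le_mul_of_nonneg_left (hx i j hi hj) (mul_nonneg (ha₀ i) (hb₀ j))

theorem le_sum_mul_of_sum_eq_one (ha₀ : ∀ i, 0 ≤ a i) (hb₀ : ∀ j, 0 ≤ b j) (ha : ∑ i, a i = 1)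
    (hb : ∑ j, b j = 1) {x : I → J → ℝ} {c : ℝ}
    (hx : ∀ i j, a i ≠ 0 → b j ≠ 0 → c ≤ x i j) : c ≤ ∑ i, ∑ j, a i * b j * x i j := by
  have h := sum_mul_le_of_sum_eq_one ha₀ hb₀ ha hb (x := fun i j => -x i j) (c := -c)
    fun i j hi hj => neg_le_neg (hx i j hi hj)
  simp only [mul_neg, Finset.sum_neg_distrib] at h
  exact neg_le_neg_iff.1 h

end Mixed

/-- Iterating the improvement from the initial bound `K` gives `D x ≤ β ^ n * K`, which tends to
zero. -/
theorem le_zero_of_contracting {X : Type*} {β : ℝ} (hβ₀ : 0 < β) (hβ₁ : β < 1) {D : X → ℝ} {K : ℝ}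
    (hK : ∀ x, D x ≤ K) (h : ∀ c, (∀ x, D x ≤ c) → ∀ x, D x ≤ β * c) (x : X) : D x ≤ 0 := by
  have hn : ∀ n : ℕ, ∀ x, D x ≤ β ^ n * K := by
    intro n
    induction n with
    | zero => simpa using hK
    | succ n ih => intro x; rw [pow_succ', mul_assoc]; exact h _ ih x
  have hlim : Filter.Tendsto (fun n : ℕ => β ^ n * K) Filter.atTop (nhds (0 * K)) :=
    (tendsto_pow_atTop_nhds_zero_of_lt_one hβ₀.le hβ₁).mul_const K
  rw [zero_mul] at hlim
  exact ge_of_tendsto' hlim fun n => hn n x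

theorem pureStationary_prob_ne_zero {S : Type*} {A B X : S → Type*} [∀ s, Fintype (X s)]
    [∀ s, DecidableEq (X s)] {f : ∀ s, X s} {h : History S A B} {s : S} {a : X s}
    (ha : (pureStationary A B f).prob h s a ≠ 0) : a = f s := by
  by_contra hne
  exact ha (if_neg hne)

/-- The strategy that plays the first stage according to `ρ` and the later ones according to `σ`. -/
def GameStrategy.startWith {S : Type*} {A B X : S → Type*} [∀ s, Fintype (X s)]
    (ρ σ : GameStrategy S A B X) : GameStrategy S A B X where
  prob
    | [] => ρ.prob []
    | x :: h => σ.prob (x :: h)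
  prob_nonneg
    | [] => ρ.prob_nonneg []
    | x :: h => σ.prob_nonneg (x :: h)
  prob_sum
    | [] => ρ.prob_sum []
    | x :: h => σ.prob_sum (x :: h)

/-- This lets the player who does not deviate be treated by the same one-stage formula as the one
who does. -/
theorem pureStationary_startWith_self {S : Type*} {A B X : S → Type*} [∀ s, Fintype (X s)]
    [∀ s, DecidableEq (X s)] (f : ∀ s, X s) :
    (pureStationary A B f).startWith (pureStationary A B f) = pureStationary A B f := by
  have h : ((pureStationary A B f).startWith (pureStationary A B f)).prob =
      (pureStationary A B f).prob := by
    funext h; cases h <;> rfl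
  cases hf : (pureStationary A B f).startWith (pureStationary A B f)
  rw [hf] at h
  cases h
  rfl

/-! ### Discounted payoffs and the Shapley inequalities. -/

namespace StochasticGame

section Transition

variable {S : Type*} {A B : S → Type*} [Fintype S] (G : StochasticGame S A B)

theorem sum_p_mul_le {s : S} {i : A s} {j : B s} {x : S → ℝ} {c : ℝ} (hx : ∀ s', x s' ≤ c) :
    ∑ s', G.p s i j s' * x s' ≤ c := by
  calc ∑ s', G.p s i j s' * x s' ≤ ∑ s', G.p s i j s' * c :=
        Finset.sum_le_sum fun s' _ => mul_le_mul_of_nonneg_left (hx s') (G.p_nonneg s i j s')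
    _ = c := by rw [← Finset.sum_mul, G.p_sum, one_mul]

theorem le_sum_p_mul {s : S} {i : A s} {j : B s} {x : S → ℝ} {c : ℝ} (hx : ∀ s', c ≤ x s') :
    c ≤ ∑ s', G.p s i j s' * x s' := by
  calc c = ∑ s', G.p s i j s' * c := by rw [← Finset.sum_mul, G.p_sum, one_mul]
    _ ≤ _ := Finset.sum_le_sum fun s' _ => mul_le_mul_of_nonneg_left (hx s') (G.p_nonneg s i j s')

end Transition

variable {S : Type*} {A B : S → Type*} [Fintype S] [∀ s, Fintype (A s)] [∀ s, Fintype (B s)]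
  (G : StochasticGame S A B) {β : ℝ} (σ : GameStrategy S A B A) (τ : GameStrategy S A B B)

theorem exists_abs_r_le : ∃ M, ∀ s i j, |G.r s i j| ≤ M := by
  obtain ⟨M, hM⟩ := Set.Finite.bddAbove
    (Set.finite_range fun x : Σ s, A s × B s => |G.r x.1 x.2.1 x.2.2|)
  exact ⟨M, fun s i j => hM ⟨⟨s, i, j⟩, rfl⟩⟩

theorem abs_stagePayoff_le {M : ℝ} (hM : ∀ s i j, |G.r s i j| ≤ M) (t : ℕ) (h : History S A B)
    (s : S) : |G.stagePayoff σ τ t h s| ≤ M := by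
  induction t generalizing h s with
  | zero =>
    rw [abs_le, stagePayoff]
    exact ⟨le_sum_mul_of_sum_eq_one (σ.prob_nonneg h s) (τ.prob_nonneg h s) (σ.prob_sum h s)
        (τ.prob_sum h s) fun i j _ _ => (abs_le.1 (hM s i j)).1,
      sum_mul_le_of_sum_eq_one (σ.prob_nonneg h s) (τ.prob_nonneg h s) (σ.prob_sum h s)
        (τ.prob_sum h s) fun i j _ _ => (abs_le.1 (hM s i j)).2⟩
  | succ t ih =>
    rw [abs_le, stagePayoff]
    exact ⟨le_sum_mul_of_sum_eq_one (σ.prob_nonneg h s) (τ.prob_nonneg h s) (σ.prob_sum h s)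
        (τ.prob_sum h s) fun i j _ _ => G.le_sum_p_mul fun s' => (abs_le.1 (ih _ s')).1,
      sum_mul_le_of_sum_eq_one (σ.prob_nonneg h s) (τ.prob_nonneg h s) (σ.prob_sum h s)
        (τ.prob_sum h s) fun i j _ _ => G.sum_p_mul_le fun s' => (abs_le.1 (ih _ s')).2⟩

/-- The expected discounted payoff to Player I from now on, when the past is `h` and the current
state is `s`. -/
noncomputable def continuationPayoff (β : ℝ) (h : History S A B) (s : S) : ℝ :=
  ∑' t : ℕ, β ^ t * G.stagePayoff σ τ t h s

theorem abs_pow_mul_stagePayoff_le (hβ₀ : 0 < β) {M : ℝ} (hM : ∀ s i j, |G.r s i j| ≤ M)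
    (h : History S A B) (s : S) (t : ℕ) : |β ^ t * G.stagePayoff σ τ t h s| ≤ β ^ t * M := by
  rw [abs_mul, abs_of_pos (pow_pos hβ₀ t)]
  exact mul_le_mul_of_nonneg_left (G.abs_stagePayoff_le σ τ hM t h s) (pow_pos hβ₀ t).le

theorem summable_stagePayoff (hβ₀ : 0 < β) (hβ₁ : β < 1) (h : History S A B) (s : S) :
    Summable fun t : ℕ => β ^ t * G.stagePayoff σ τ t h s := by
  obtain ⟨M, hM⟩ := G.exists_abs_r_le
  exact Summable.of_norm_bounded ((summable_geometric_of_lt_one hβ₀.le hβ₁).mul_right M)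
    (G.abs_pow_mul_stagePayoff_le σ τ hβ₀ hM h s)

theorem exists_abs_continuationPayoff_le (hβ₀ : 0 < β) (hβ₁ : β < 1) :
    ∃ K, ∀ h s, |G.continuationPayoff σ τ β h s| ≤ K := by
  obtain ⟨M, hM⟩ := G.exists_abs_r_le
  exact ⟨(1 - β)⁻¹ * M, fun h s => tsum_of_norm_bounded
    (f := fun t : ℕ => β ^ t * G.stagePayoff σ τ t h s)
    ((hasSum_geometric_of_lt_one hβ₀.le hβ₁).mul_right M)
    (G.abs_pow_mul_stagePayoff_le σ τ hβ₀ hM h s)⟩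

/-- The term `t = 0` is the current reward. The tail is `β` times an average of continuation
payoffs, because all the averages are finite sums and commute with the series. -/
theorem continuationPayoff_eq (hβ₀ : 0 < β) (hβ₁ : β < 1) (h : History S A B) (s : S) :
    G.continuationPayoff σ τ β h s = ∑ i, ∑ j, σ.prob h s i * τ.prob h s j *
      (G.r s i j + β * ∑ s', G.p s i j s' * G.continuationPayoff σ τ β (⟨s, i, j⟩ :: h) s') := by
  have hs : HasSum (fun t : ℕ => β ^ (t + 1) * G.stagePayoff σ τ (t + 1) h s)
      (∑ i, ∑ j, σ.prob h s i * τ.prob h s j *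
        (β * ∑ s', G.p s i j s' * G.continuationPayoff σ τ β (⟨s, i, j⟩ :: h) s')) := by
    have := hasSum_sum (s := Finset.univ) fun i (_ : i ∈ Finset.univ) =>
      hasSum_sum (s := Finset.univ) fun j (_ : j ∈ Finset.univ) =>
        (((hasSum_sum (s := Finset.univ) fun s' (_ : s' ∈ Finset.univ) =>
          ((G.summable_stagePayoff σ τ hβ₀ hβ₁ (⟨s, i, j⟩ :: h) s').hasSum.mul_left
            (G.p s i j s'))).mul_left β).mul_left (σ.prob h s i * τ.prob h s j))
    refine this.congr_fun fun t => ?_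
    simp only [stagePayoff, Finset.mul_sum]
    refine Finset.sum_congr rfl fun i _ => Finset.sum_congr rfl fun j _ =>
      Finset.sum_congr rfl fun s' _ => ?_
    ring
  rw [continuationPayoff, (G.summable_stagePayoff σ τ hβ₀ hβ₁ h s).tsum_eq_zero_add, hs.tsum_eq]
  simp only [stagePayoff, pow_zero, one_mul, mul_add, Finset.sum_add_distrib]

theorem discountedPayoff_eq_continuationPayoff (β : ℝ) (s : S) :
    G.discountedPayoff β σ τ s = G.continuationPayoff σ τ β [] s := rfl

variable [∀ s, DecidableEq (A s)] [∀ s, DecidableEq (B s)] {v : S → ℝ} {f : ∀ s, A s}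
  {g : ∀ s, B s}

omit [∀ s, DecidableEq (A s)] in
-- The contraction runs over pairs of history and state: `σ` may depend on the history, so a bound
-- on the excess over `v` must hold after every history at once to be usable one stage later.
theorem continuationPayoff_pureStationary_le (hβ₀ : 0 < β) (hβ₁ : β < 1)
    (hg : ∀ s i, G.r s i (g s) + β * ∑ s', G.p s i (g s) s' * v s' ≤ v s) (h : History S A B)
    (s : S) : G.continuationPayoff σ (pureStationary A B g) β h s ≤ v s := by
  obtain ⟨K, hK⟩ := G.exists_abs_continuationPayoff_le σ (pureStationary A B g) hβ₀ hβ₁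
  obtain ⟨L, hL⟩ := (Set.finite_range fun s => -v s).bddAbove
  have key := le_zero_of_contracting hβ₀ hβ₁ (K := K + L)
    (D := fun x : History S A B × S =>
      G.continuationPayoff σ (pureStationary A B g) β x.1 x.2 - v x.2)
    (fun x => by
      have h₁ := (abs_le.1 (hK x.1 x.2)).2
      have h₂ : -v x.2 ≤ L := hL ⟨x.2, rfl⟩
      linarith)
    (fun c hc x => by
      obtain ⟨h, s⟩ := x
      rw [sub_le_iff_le_add, G.continuationPayoff_eq _ _ hβ₀ hβ₁]
      refine sum_mul_le_of_sum_eq_one (σ.prob_nonneg h s) (GameStrategy.prob_nonneg _ h s)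
        (σ.prob_sum h s) (GameStrategy.prob_sum _ h s) fun i j _ hj => ?_
      rw [pureStationary_prob_ne_zero hj]
      have h₁ := G.sum_p_mul_le (s := s) (i := i) (j := g s) fun s' =>
        hc (⟨s, i, g s⟩ :: h, s')
      simp only [mul_sub, Finset.sum_sub_distrib] at h₁
      have h₂ := mul_le_mul_of_nonneg_left h₁ hβ₀.le
      linarith [hg s i])
    (h, s)
  exact sub_nonpos.1 key

omit [∀ s, DecidableEq (B s)] in
theorem le_continuationPayoff_pureStationary (hβ₀ : 0 < β) (hβ₁ : β < 1)
    (hf : ∀ s j, v s ≤ G.r s (f s) j + β * ∑ s', G.p s (f s) j s' * v s') (h : History S A B)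
    (s : S) : v s ≤ G.continuationPayoff (pureStationary A B f) τ β h s := by
  obtain ⟨K, hK⟩ := G.exists_abs_continuationPayoff_le (pureStationary A B f) τ hβ₀ hβ₁
  obtain ⟨L, hL⟩ := (Set.finite_range v).bddAbove
  have key := le_zero_of_contracting hβ₀ hβ₁ (K := L + K)
    (D := fun x : History S A B × S =>
      v x.2 - G.continuationPayoff (pureStationary A B f) τ β x.1 x.2)
    (fun x => by
      have h₁ := (abs_le.1 (hK x.1 x.2)).1
      have h₂ : v x.2 ≤ L := hL ⟨x.2, rfl⟩
      linarith)
    (fun c hc x => by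
      obtain ⟨h, s⟩ := x
      -- The goal becomes the lower bound `v s - β * c` for an average of one-stage expressions.
      rw [sub_le_comm, G.continuationPayoff_eq _ _ hβ₀ hβ₁]
      refine le_sum_mul_of_sum_eq_one (GameStrategy.prob_nonneg _ h s) (τ.prob_nonneg h s)
        (GameStrategy.prob_sum _ h s) (τ.prob_sum h s) fun i j hi _ => ?_
      rw [pureStationary_prob_ne_zero hi]
      have h₁ := G.sum_p_mul_le (s := s) (i := f s) (j := j) fun s' =>
        hc (⟨s, f s, j⟩ :: h, s')
      simp only [mul_sub, Finset.sum_sub_distrib] at h₁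
      have h₂ := mul_le_mul_of_nonneg_left h₁ hβ₀.le
      linarith [hf s j])
    (h, s)
  exact sub_nonpos.1 key

theorem ShapleyInequalities.isOptimalPair (hβ₀ : 0 < β) (hβ₁ : β < 1)
    (h : G.ShapleyInequalities β v f g) :
    G.IsOptimalPair β v (pureStationary A B f) (pureStationary A B g) := fun s =>
  have h₁ σ' := G.continuationPayoff_pureStationary_le σ' hβ₀ hβ₁ (fun s i => (h s).1 i) [] s
  have h₂ τ' := G.le_continuationPayoff_pureStationary τ' hβ₀ hβ₁ (fun s j => (h s).2 j) [] s
  ⟨h₁, le_antisymm (h₁ _) (h₂ _), h₂⟩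

omit [∀ s, DecidableEq (A s)] [∀ s, DecidableEq (B s)] in
-- Since `h'` is arbitrary, the hypotheses make `σ` and `τ` independent of the history and let `σ'`
-- and `τ'` agree with them once a stage has been played. Thus play after one stage can be compared
-- with play from the empty history.
theorem stagePayoff_congr {σ σ' : GameStrategy S A B A} {τ τ' : GameStrategy S A B B}
    (hσ : ∀ h h' s, h ≠ [] → σ'.prob h s = σ.prob h' s)
    (hτ : ∀ h h' s, h ≠ [] → τ'.prob h s = τ.prob h' s) (t : ℕ) (h h' : History S A B)
    (hh : h ≠ []) (s : S) : G.stagePayoff σ' τ' t h s = G.stagePayoff σ τ t h' s := by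
  induction t generalizing h h' s with
  | zero => rw [stagePayoff, stagePayoff, hσ h h' s hh, hτ h h' s hh]
  | succ t ih =>
    rw [stagePayoff, stagePayoff, hσ h h' s hh, hτ h h' s hh]
    simp only [fun i j => ih (⟨s, i, j⟩ :: h) (⟨s, i, j⟩ :: h') (List.cons_ne_nil _ _)]

theorem discountedPayoff_startWith (hβ₀ : 0 < β) (hβ₁ : β < 1) (f' f : ∀ s, A s)
    (g' g : ∀ s, B s) (s : S) :
    G.discountedPayoff β ((pureStationary A B f').startWith (pureStationary A B f))
        ((pureStationary A B g').startWith (pureStationary A B g)) s =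
      G.r s (f' s) (g' s) + β * ∑ s', G.p s (f' s) (g' s) s' *
        G.discountedPayoff β (pureStationary A B f) (pureStationary A B g) s' := by
  have hc : ∀ x s', G.continuationPayoff
      ((pureStationary A B f').startWith (pureStationary A B f))
      ((pureStationary A B g').startWith (pureStationary A B g)) β [x] s' =
      G.discountedPayoff β (pureStationary A B f) (pureStationary A B g) s' := by
    intro x s'
    refine tsum_congr fun t => congrArg _ (G.stagePayoff_congr ?_ ?_ t _ _ (List.cons_ne_nil _ _) s')
    all_goals
      intro h h' s hh
      cases h with
      | nil => exact absurd rfl hh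
      | cons y h => rfl
  rw [discountedPayoff_eq_continuationPayoff, G.continuationPayoff_eq _ _ hβ₀ hβ₁]
  simp only [hc]
  simp [GameStrategy.startWith, pureStationary]

theorem IsOptimalPair.shapleyInequalities (hβ₀ : 0 < β) (hβ₁ : β < 1)
    (h : G.IsOptimalPair β v (pureStationary A B f) (pureStationary A B g)) :
    G.ShapleyInequalities β v f g := by
  classical
  refine fun s => ⟨fun i => ?_, fun j => ?_⟩
  · have h₁ := (h s).1 ((pureStationary A B (Function.update f s i)).startWith
      (pureStationary A B f))
    -- Player II's strategy is written as a trivial one-stage deviation; the continuation payoffs in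
    -- the resulting formula are then `v`, by optimality.
    rw [← pureStationary_startWith_self g, G.discountedPayoff_startWith hβ₀ hβ₁] at h₁
    simpa only [Function.update_self, fun s => (h s).2.1] using h₁
  · have h₁ := (h s).2.2 ((pureStationary A B (Function.update g s j)).startWith
      (pureStationary A B g))
    rw [← pureStationary_startWith_self f, G.discountedPayoff_startWith hβ₀ hβ₁] at h₁
    simpa only [Function.update_self, fun s => (h s).2.1] using h₁

end StochasticGame

/-! ### Additive games: shifted rewards, separation, and the complementarity problem. -/

namespace ARATGame

variable {S : Type*} {A B : S → Type*} [Fintype S] (G : ARATGame S A B) {β : ℝ}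

section Shift

variable [∀ s, Fintype (A s)] [∀ s, Fintype (B s)] (c₁ c₂ : ℝ)

theorem exists_shift_positiveRewards : ∃ c₁ c₂ : ℝ, (G.shift c₁ c₂).PositiveRewards := by
  obtain ⟨c₁, h₁⟩ := (Set.finite_range fun x : Σ s, A s => -G.r₁ x.1 x.2).bddAbove
  obtain ⟨c₂, h₂⟩ := (Set.finite_range fun x : Σ s, B s => -G.r₂ x.1 x.2).bddAbove
  -- The upper bounds on the negated rewards alone give only nonnegativity; the added 1 makes it
  -- strict.
  refine ⟨c₁ + 1, c₂ + 1, fun s i => ?_, fun s j => ?_⟩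
  · have : -G.r₁ s i ≤ c₁ := h₁ ⟨⟨s, i⟩, rfl⟩
    simp only [shift]
    linarith
  · have : -G.r₂ s j ≤ c₂ := h₂ ⟨⟨s, j⟩, rfl⟩
    simp only [shift]
    linarith

/-- Action and transition probabilities sum to one, so a constant passes unchanged through every
average. -/
theorem stagePayoff_shift (σ : GameStrategy S A B A) (τ : GameStrategy S A B B) (t : ℕ)
    (h : History S A B) (s : S) : (G.shift c₁ c₂).toStochasticGame.stagePayoff σ τ t h s =
      G.toStochasticGame.stagePayoff σ τ t h s + (c₁ + c₂) := by
  induction t generalizing h s with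
  | zero =>
    rw [StochasticGame.stagePayoff, StochasticGame.stagePayoff,
      ← sum_mul_const_of_sum_eq_one (σ.prob_sum h s) (τ.prob_sum h s) (c₁ + c₂)]
    simp only [← Finset.sum_add_distrib, ← mul_add]
    refine Finset.sum_congr rfl fun i _ => Finset.sum_congr rfl fun j _ => ?_
    simp only [toStochasticGame, shift]
    ring
  | succ t ih =>
    rw [StochasticGame.stagePayoff, StochasticGame.stagePayoff,
      ← sum_mul_const_of_sum_eq_one (σ.prob_sum h s) (τ.prob_sum h s) (c₁ + c₂)]
    simp only [← Finset.sum_add_distrib, ← mul_add, ih]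
    refine Finset.sum_congr rfl fun i _ => Finset.sum_congr rfl fun j _ => congrArg _ ?_
    simp only [mul_add _ _ (c₁ + c₂), Finset.sum_add_distrib, ← Finset.sum_mul,
      StochasticGame.p_sum, one_mul]
    rfl

theorem discountedPayoff_shift (hβ₀ : 0 < β) (hβ₁ : β < 1) (σ : GameStrategy S A B A)
    (τ : GameStrategy S A B B) (s : S) :
    (G.shift c₁ c₂).toStochasticGame.discountedPayoff β σ τ s =
      G.toStochasticGame.discountedPayoff β σ τ s + (c₁ + c₂) / (1 - β) := by
  have h := (G.toStochasticGame.summable_stagePayoff σ τ hβ₀ hβ₁ [] s).hasSum.add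
    ((hasSum_geometric_of_lt_one hβ₀.le hβ₁).mul_right (c₁ + c₂))
  simp only [← mul_add, ← stagePayoff_shift] at h
  rw [StochasticGame.discountedPayoff, h.tsum_eq, div_eq_inv_mul]
  rfl

theorem isOptimalPair_shift_iff (hβ₀ : 0 < β) (hβ₁ : β < 1) (v : S → ℝ)
    (σ : GameStrategy S A B A) (τ : GameStrategy S A B B) :
    (G.shift c₁ c₂).toStochasticGame.IsOptimalPair β (fun s => v s + (c₁ + c₂) / (1 - β)) σ τ ↔
      G.toStochasticGame.IsOptimalPair β v σ τ := by
  simp only [StochasticGame.IsOptimalPair, G.discountedPayoff_shift c₁ c₂ hβ₀ hβ₁,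
    add_le_add_iff_right, add_left_inj]

end Shift

/-- This is the only place where additivity separates the players: each summand depends on one
player's action. -/
theorem reward_add_eq (v : S → ℝ) (s : S) (i : A s) (j : B s) :
    G.toStochasticGame.r s i j + β * ∑ s', G.toStochasticGame.p s i j s' * v s' =
      G.part₁ β v s i + G.part₂ β v s j := by
  simp only [toStochasticGame, part₁, part₂, add_mul, Finset.sum_add_distrib]
  ring

theorem shapleyInequalities_of_part {η ξ : S → ℝ} {f : ∀ s, A s} {g : ∀ s, B s}
    (h₁ : ∀ s i, G.part₁ β (ξ + η) s i ≤ ξ s) (h₂ : ∀ s j, η s ≤ G.part₂ β (ξ + η) s j)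
    (hf : ∀ s, ξ s = G.part₁ β (ξ + η) s (f s)) (hg : ∀ s, η s = G.part₂ β (ξ + η) s (g s)) :
    G.toStochasticGame.ShapleyInequalities β (ξ + η) f g := by
  refine fun s => ⟨fun i => ?_, fun j => ?_⟩
  · rw [G.reward_add_eq, ← hg s]
    exact add_le_add_left (h₁ s i) _
  · rw [G.reward_add_eq, ← hf s]
    exact add_le_add_right (h₂ s j) _

variable [DecidableEq S]

/-- Both column groups contain `-β P₁`, which therefore acts on `ξ + η`, while the block identity
picks out `ξ s`. The complementary variable of this block is nevertheless `η s`. -/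
theorem verticalMatrix_mulVec_inl (z : S ⊕ S → ℝ) (s : S) (i : A s) :
    (G.verticalMatrix β).mulVec z (Sum.inl ⟨s, i⟩) + G.rhs (Sum.inl ⟨s, i⟩) =
      z (Sum.inr s) - G.part₁ β (fun s => z (Sum.inr s) + z (Sum.inl s)) s i := by
  simp [verticalMatrix, Matrix.mulVec, dotProduct, rhs, part₁, P₁, blockIdentity, sub_mul, mul_add,
    Finset.sum_add_distrib, Finset.mul_sum, mul_assoc]
  ring

theorem verticalMatrix_mulVec_inr (z : S ⊕ S → ℝ) (s : S) (j : B s) :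
    (G.verticalMatrix β).mulVec z (Sum.inr ⟨s, j⟩) + G.rhs (Sum.inr ⟨s, j⟩) =
      G.part₂ β (fun s => z (Sum.inr s) + z (Sum.inl s)) s j - z (Sum.inl s) := by
  simp [verticalMatrix, Matrix.mulVec, dotProduct, rhs, part₂, P₂, blockIdentity, add_mul, mul_add,
    Finset.sum_add_distrib, Finset.mul_sum, mul_assoc]
  ring

variable [∀ s, Fintype (A s)] [∀ s, Fintype (B s)]

theorem prod_block_inl_eq_zero_iff (w : (Σ s, A s) ⊕ (Σ s, B s) → ℝ) (s : S) :
    ∏ p with block A B p = Sum.inl s, w p = 0 ↔ ∃ i, w (Sum.inl ⟨s, i⟩) = 0 := by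
  simp only [Finset.prod_eq_zero_iff, Finset.mem_filter, Finset.mem_univ, true_and]
  constructor
  · rintro ⟨⟨s', i⟩ | ⟨s', j⟩, hp, hw⟩
    · obtain rfl : s' = s := Sum.inl.inj hp
      exact ⟨i, hw⟩
    · cases hp
  · rintro ⟨i, hw⟩
    exact ⟨_, rfl, hw⟩

theorem prod_block_inr_eq_zero_iff (w : (Σ s, A s) ⊕ (Σ s, B s) → ℝ) (s : S) :
    ∏ p with block A B p = Sum.inr s, w p = 0 ↔ ∃ j, w (Sum.inr ⟨s, j⟩) = 0 := by
  simp only [Finset.prod_eq_zero_iff, Finset.mem_filter, Finset.mem_univ, true_and]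
  constructor
  · rintro ⟨⟨s', i⟩ | ⟨s', j⟩, hp, hw⟩
    · cases hp
    · obtain rfl : s' = s := Sum.inr.inj hp
      exact ⟨j, hw⟩
  · rintro ⟨j, hw⟩
    exact ⟨_, rfl, hw⟩

theorem isVLCPSolution_iff (w : (Σ s, A s) ⊕ (Σ s, B s) → ℝ) (z : S ⊕ S → ℝ) :
    IsVLCPSolution (block A B) (G.verticalMatrix β) G.rhs w z ↔
      (∀ s i, w (Sum.inl ⟨s, i⟩) =
        z (Sum.inr s) - G.part₁ β (fun s => z (Sum.inr s) + z (Sum.inl s)) s i) ∧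
      (∀ s j, w (Sum.inr ⟨s, j⟩) =
        G.part₂ β (fun s => z (Sum.inr s) + z (Sum.inl s)) s j - z (Sum.inl s)) ∧
      0 ≤ w ∧ 0 ≤ z ∧
      (∀ s, z (Sum.inl s) = 0 ∨ ∃ i, w (Sum.inl ⟨s, i⟩) = 0) ∧
      ∀ s, z (Sum.inr s) = 0 ∨ ∃ j, w (Sum.inr ⟨s, j⟩) = 0 := by
  simp only [IsVLCPSolution, Sum.forall, mul_eq_zero, prod_block_inl_eq_zero_iff,
    prod_block_inr_eq_zero_iff, sub_eq_iff_eq_add', funext_iff (f := w), Pi.add_apply, Sigma.forall,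
    verticalMatrix_mulVec_inl, verticalMatrix_mulVec_inr, and_assoc]

/-- Feasibility of Player I's rows gives `ξ s ≥ part₁ > 0`. As `ξ s` is complementary to Player II's
rows, one of these is tight, and there `η s = part₂ > 0`. -/
theorem pos_of_isVLCPSolution [∀ s, Nonempty (A s)] (hβ₀ : 0 < β) (hr : G.PositiveRewards)
    {w : (Σ s, A s) ⊕ (Σ s, B s) → ℝ} {z : S ⊕ S → ℝ}
    (h : IsVLCPSolution (block A B) (G.verticalMatrix β) G.rhs w z) (c : S ⊕ S) : 0 < z c := by
  obtain ⟨h₁, h₂, hw, hz, -, hr'⟩ := (G.isVLCPSolution_iff w z).1 h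
  have hv : ∀ s, 0 ≤ z (Sum.inr s) + z (Sum.inl s) := fun s => add_nonneg (hz _) (hz _)
  have hξ : ∀ s, 0 < z (Sum.inr s) := by
    intro s
    obtain ⟨i⟩ := ‹∀ s, Nonempty (A s)› s
    have hp : 0 < G.part₁ β (fun s => z (Sum.inr s) + z (Sum.inl s)) s i :=
      add_pos_of_pos_of_nonneg (hr.1 s i) (mul_nonneg hβ₀.le
        (Finset.sum_nonneg fun s' _ => mul_nonneg (G.p₁_nonneg s i s') (hv s')))
    have := hw (Sum.inl ⟨s, i⟩)
    rw [h₁ s i] at this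
    exact hp.trans_le (sub_nonneg.1 this)
  rcases c with s | s
  · obtain ⟨j, hj⟩ := (hr' s).resolve_left (hξ s).ne'
    have hp : 0 < G.part₂ β (fun s => z (Sum.inr s) + z (Sum.inl s)) s j :=
      add_pos_of_pos_of_nonneg (hr.2 s j) (mul_nonneg hβ₀.le
        (Finset.sum_nonneg fun s' _ => mul_nonneg (G.p₂_nonneg s j s') (hv s')))
    rw [h₂ s j, sub_eq_zero] at hj
    rwa [← hj]
  · exact hξ s

theorem shapleyInequalities_of_isVLCPSolution {w : (Σ s, A s) ⊕ (Σ s, B s) → ℝ} {z : S ⊕ S → ℝ}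
    (h : IsVLCPSolution (block A B) (G.verticalMatrix β) G.rhs w z) {f : ∀ s, A s} {g : ∀ s, B s}
    (hf : ∀ s, w (Sum.inl ⟨s, f s⟩) = 0) (hg : ∀ s, w (Sum.inr ⟨s, g s⟩) = 0) :
    G.toStochasticGame.ShapleyInequalities β (fun s => z (Sum.inr s) + z (Sum.inl s)) f g ∧
      (∀ s, z (Sum.inr s) = G.part₁ β (fun s => z (Sum.inr s) + z (Sum.inl s)) s (f s)) ∧
      ∀ s, z (Sum.inl s) = G.part₂ β (fun s => z (Sum.inr s) + z (Sum.inl s)) s (g s) := by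
  obtain ⟨h₁, h₂, hw, -, -, -⟩ := (G.isVLCPSolution_iff w z).1 h
  have hf' : ∀ s, z (Sum.inr s) = G.part₁ β (fun s => z (Sum.inr s) + z (Sum.inl s)) s (f s) :=
    fun s => sub_eq_zero.1 ((h₁ s (f s)).symm.trans (hf s))
  have hg' : ∀ s, z (Sum.inl s) = G.part₂ β (fun s => z (Sum.inr s) + z (Sum.inl s)) s (g s) :=
    fun s => (sub_eq_zero.1 ((h₂ s (g s)).symm.trans (hg s))).symm
  refine ⟨G.shapleyInequalities_of_part (η := fun s => z (Sum.inl s)) (ξ := fun s => z (Sum.inr s))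
    (fun s i => ?_) (fun s j => ?_) hf' hg', hf', hg'⟩
  · exact sub_nonneg.1 ((hw (Sum.inl ⟨s, i⟩)).trans_eq (h₁ s i))
  · exact sub_nonneg.1 ((hw (Sum.inr ⟨s, j⟩)).trans_eq (h₂ s j))

theorem exists_isVLCPSolution_iff {η ξ : S → ℝ} (hη : ∀ s, 0 < η s) (hξ : ∀ s, 0 < ξ s) :
    (∃ w, IsVLCPSolution (block A B) (G.verticalMatrix β) G.rhs w (Sum.elim η ξ)) ↔
      ∃ (f : ∀ s, A s) (g : ∀ s, B s),
        G.toStochasticGame.ShapleyInequalities β (ξ + η) f g ∧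
        (∀ s, ξ s = G.part₁ β (ξ + η) s (f s)) ∧ ∀ s, η s = G.part₂ β (ξ + η) s (g s) := by
  constructor
  · rintro ⟨w, h⟩
    obtain ⟨-, -, -, -, hl, hr⟩ := (G.isVLCPSolution_iff w _).1 h
    choose f hf using fun s => (hl s).resolve_left (hη s).ne'
    choose g hg using fun s => (hr s).resolve_left (hξ s).ne'
    exact ⟨f, g, G.shapleyInequalities_of_isVLCPSolution h hf hg⟩
  · rintro ⟨f, g, h, hf, hg⟩
    -- The slack vector is forced by `z`; the actions `f s` and `g s` provide its zeros.
    refine ⟨Sum.elim (fun a => ξ a.1 - G.part₁ β (ξ + η) a.1 a.2)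
      (fun b => G.part₂ β (ξ + η) b.1 b.2 - η b.1), (G.isVLCPSolution_iff _ _).2
      ⟨fun s i => rfl, fun s j => rfl, ?_, ?_, fun s => Or.inr ⟨f s, sub_eq_zero.2 (hf s)⟩,
        fun s => Or.inr ⟨g s, sub_eq_zero.2 (hg s).symm⟩⟩⟩
    · rintro (⟨s, i⟩ | ⟨s, j⟩)
      -- With Player II at `g s`, the summand `part₂` equals `η s` and cancels from the Shapley
      -- inequality, leaving `part₁ ≤ ξ s`.
      · have := (h s).1 i
        rw [G.reward_add_eq, ← hg s] at this
        exact sub_nonneg.2 (le_of_add_le_add_right this)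
      · have := (h s).2 j
        rw [G.reward_add_eq, ← hf s] at this
        exact sub_nonneg.2 (le_of_add_le_add_left this)
    · rintro (s | s)
      · exact (hη s).le
      · exact (hξ s).le

end ARATGame

theorem mainTheorem3 {S : Type*} {A B : S → Type*} [Fintype S] [DecidableEq S]
    [∀ s, Fintype (A s)] [∀ s, DecidableEq (A s)] [∀ s, Nonempty (A s)]
    [∀ s, Fintype (B s)] [∀ s, DecidableEq (B s)] [∀ s, Nonempty (B s)]
    (G : ARATGame S A B) (β : ℝ) (hβ₀ : 0 < β) (hβ₁ : β < 1) :
    -- A pair of pure stationary strategies is optimal with value `v` iff the Shapley inequalities hold.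
    (∀ (v : S → ℝ) (f : ∀ s, A s) (g : ∀ s, B s),
      G.toStochasticGame.IsOptimalPair β v (pureStationary A B f) (pureStationary A B g) ↔
        G.toStochasticGame.ShapleyInequalities β v f g) ∧
    -- For positive `η`, `ξ`, the Shapley inequalities amount to VLCP.
    (∀ η ξ : S → ℝ, (∀ s, 0 < η s) → (∀ s, 0 < ξ s) →
      ((∃ w, IsVLCPSolution (ARATGame.block A B) (G.verticalMatrix β) G.rhs w (Sum.elim η ξ)) ↔
        ∃ (f : ∀ s, A s) (g : ∀ s, B s),
          G.toStochasticGame.ShapleyInequalities β (ξ + η) f g ∧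
          (∀ s, ξ s = G.part₁ β (ξ + η) s (f s)) ∧ ∀ s, η s = G.part₂ β (ξ + η) s (g s))) ∧
    -- The positivity is automatic for positive rewards, which one may assume.
    (G.PositiveRewards → ∀ w z,
      IsVLCPSolution (ARATGame.block A B) (G.verticalMatrix β) G.rhs w z → ∀ j, 0 < z j) ∧
    (∃ c₁ c₂ : ℝ, (G.shift c₁ c₂).PositiveRewards) ∧
    (∀ (c₁ c₂ : ℝ) (v : S → ℝ) (σ : GameStrategy S A B A) (τ : GameStrategy S A B B),
      (G.shift c₁ c₂).toStochasticGame.IsOptimalPair β (fun s => v s + (c₁ + c₂) / (1 - β)) σ τ ↔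
        G.toStochasticGame.IsOptimalPair β v σ τ) ∧
    -- VLCP is equivalent to LCP.
    (∀ w z, IsVLCPSolution (ARATGame.block A B) (G.verticalMatrix β) G.rhs w z ↔
      ∃ x, IsLCPSolution (G.squareMatrix β) G.rhs w x ∧ blockSum (ARATGame.block A B) x = z) ∧
    -- The homotopy function as `t → 0`.
    (∀ u₀ ∈ regionOpen (G.squareMatrix β) G.rhs,
      -- Along a bounded set of zeros with `t → 0` there is a limit.
      (∀ C ⊆ homotopyZeros (G.squareMatrix β) G.rhs u₀, Bornology.IsBounded C →
        (0 : ℝ) ∈ closure (Prod.snd '' C) → ∃ u, (u, (0 : ℝ)) ∈ closure C) ∧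
      -- Every limit as `t → 0` is a zero at `t = 0` in the closed region.
      (∀ u, (u, (0 : ℝ)) ∈ closure (homotopyZeros (G.squareMatrix β) G.rhs u₀) →
        u ∈ regionClosed (G.squareMatrix β) G.rhs ∧
          homotopy (G.squareMatrix β) G.rhs u₀ u 0 = 0) ∧
      -- Every zero at `t = 0` in the closed region solves LCP, VLCP and the game.
      (∀ u ∈ regionClosed (G.squareMatrix β) G.rhs,
        homotopy (G.squareMatrix β) G.rhs u₀ u 0 = 0 →
        ∀ w z, w = (G.squareMatrix β).mulVec u.1 + G.rhs →
          z = blockSum (ARATGame.block A B) u.1 →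
          IsLCPSolution (G.squareMatrix β) G.rhs w u.1 ∧
          IsVLCPSolution (ARATGame.block A B) (G.verticalMatrix β) G.rhs w z ∧
          (G.PositiveRewards → ∀ j, 0 < z j) ∧
          ((∀ j, 0 < z j) →
            (∀ s, ∃ i : A s, w (Sum.inl ⟨s, i⟩) = 0) ∧
            (∀ s, ∃ j : B s, w (Sum.inr ⟨s, j⟩) = 0) ∧
            ∀ (f : ∀ s, A s) (g : ∀ s, B s),
              (∀ s, w (Sum.inl ⟨s, f s⟩) = 0) → (∀ s, w (Sum.inr ⟨s, g s⟩) = 0) →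
              G.toStochasticGame.IsOptimalPair β (fun s => z (Sum.inr s) + z (Sum.inl s))
                (pureStationary A B f) (pureStationary A B g)))) := by
  have hpos : G.PositiveRewards → ∀ w z,
      IsVLCPSolution (ARATGame.block A B) (G.verticalMatrix β) G.rhs w z → ∀ j, 0 < z j :=
    fun hr _ _ h => G.pos_of_isVLCPSolution hβ₀ hr h
  refine ⟨fun v f g => ⟨fun h => h.shapleyInequalities _ hβ₀ hβ₁, fun h => h.isOptimalPair _ hβ₀ hβ₁⟩,
    fun η ξ hη hξ => G.exists_isVLCPSolution_iff hη hξ, hpos, G.exists_shift_positiveRewards,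
    fun c₁ c₂ => G.isOptimalPair_shift_iff c₁ c₂ hβ₀ hβ₁,
    fun w z => ⟨fun h => h.exists_isLCPSolution, ?_⟩, fun u₀ _ => ⟨?_, ?_, ?_⟩⟩
  · rintro ⟨x, hx, rfl⟩
    exact hx.isVLCPSolution
  · exact fun C _ hC ht => exists_mem_closure_of_mem_closure_snd hC ht
  · exact fun u hu => mem_regionClosed_and_homotopy_eq_zero hu
  · rintro u hu h w z rfl rfl
    have hL := isLCPSolution_of_homotopy_eq_zero hu h
    have hV := hL.isVLCPSolution
    -- These alternatives give a zero of `w` in every block as soon as `z` is positive.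
    obtain ⟨-, -, -, -, hl, hr⟩ := (G.isVLCPSolution_iff _ _).1 hV
    refine ⟨hL, hV, fun hp => hpos hp _ _ hV, fun hz =>
      ⟨fun s => (hl s).resolve_left (hz _).ne', fun s => (hr s).resolve_left (hz _).ne',
        fun f g hf hg => ?_⟩⟩
    exact (G.shapleyInequalities_of_isVLCPSolution hV hf hg).1.isOptimalPair _ hβ₀ hβ₁
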